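/- Theorem (Bochner $P$-separation with maximum mean discrepancies). Let $\mathcal X$ be a Radon space, that is, a separable metric space such that for every Borel probability measure $\mu$ on $\mathcal X$, every Borel set $B$ and every $\epsilon>0$ there is a compact $K\subseteq B$ with $\mu(B\setminus K)\le\epsilon$. Let $k:\mathcal X\times\mathcal X\to\mathbb R$ be a continuous kernel (symmetric and positive semidefinite), with reproducing kernel Hilbert space $\mathcal H_k$ and closed unit ball $\mathcal B_k=\{h\in\mathcal H_k:\|h\|_k\le1\}$, and write $\sqrt k$ for the function $x\mapsto\sqrt{k(x,x)}$. Let $\mathcal P$ be the set of Borel probability measures on $\mathcal X$ and $\mathcal P_{\sqrt k}=\{Q\in\mathcal P:\sqrt k\in L^1(Q)\}$ the set of Bochner-embeddable ones; write $Qh=\int h\,dQ$. For $P\in\mathcal P_{\sqrt k}$ and $Q\in\mathcal P$ put $$\mathrm{MMD}_k(Q,P)=\sup\{|Qh-Ph| : h\in\mathcal B_k,\ \max(h,0)\in L^1(Q)\}\in[0,\infty],$$ and say that $k$ separates $P$ from $\mathcal M\subseteq\mathcal P$ if, for $Q\in\mathcal M$, $\mathrm{MMD}_k(Q,P)=0$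 implies $Q=P$. Fix $P\in\mathcal P_{\sqrt k}$. 1. $k$ separates $P$ from $\mathcal P_{\sqrt k}$ if and only if, for every sequence $(Q_n)_n$ in $\mathcal P_{\sqrt k}$, the following two conditions are equivalent: (i) $Q_nh\to Ph$ for every continuous $h:\mathcal X\to\mathbb R$ for which $h/(1+\sqrt k)$ is bounded; (ii) (a) $\mathrm{MMD}_k(Q_n,P)\to0$; (b) $(Q_n)_n$ is tight, i.e. for each $\epsilon>0$ there is a compact $S\subseteq\mathcal X$ with $Q_n(\mathcal X\setminus S)\le\epsilon$ for all $n$; and (c) $(Q_n)_n$ uniformly integrates $\sqrt k$, i.e. for each $\epsilon>0$ there is $r>0$ with $\sup_n\int_{\{\sqrt k>r\}}\sqrt k\,dQ_n<\epsilon$. 2. In particular, if $k$ is bounded, then $k$ separates $P$ from all of $\mathcal P$ if and only if $k$ controls tight $P$-convergence: for every sequence $(Q_n)_n$ in $\mathcal P$ that is tight and satisfies $\mathrm{MMD}_k(Q_n,P)\to0$, $Q_n\to P$ weakly. -/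

import Mathlib

open MeasureTheory Filter Topology Set
open scoped ENNReal

namespace KernelMMD

/-- A separable metric space is a Radon space if every Borel probability measure on it is inner
regular with respect to compact sets.  (Metrizability, separability and the Borel structure are
supplied as type classes in the theorem.) -/
def IsRadonSpace (X : Type*) [TopologicalSpace X] [MeasurableSpace X] : Prop :=
  ∀ μ : Measure X, IsProbabilityMeasure μ → ∀ B : Set X, MeasurableSet B →
    ∀ ε : ℝ≥0∞, 0 < ε → ∃ K ⊆ B, IsCompact K ∧ μ (B \ K) ≤ ε

/-- A (real, scalar) kernel: symmetric, with all finite quadratic forms nonnegative. -/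
def IsKernel {X : Type*} (k : X → X → ℝ) : Prop :=
  (∀ x y, k x y = k y x) ∧
    ∀ (s : Finset X) (c : X → ℝ), 0 ≤ ∑ x ∈ s, ∑ y ∈ s, c x * c y * k x y

/-- The scalar kernel `k`, as a matrix of operators on `ℝ`: the entry at `(x, y)` is multiplication
by `k x y`. This is the form in which Mathlib's construction of the RKHS takes its kernel. -/
noncomputable def opKernel {X : Type*} (k : X → X → ℝ) : Matrix X X (ℝ →L[ℝ] ℝ) :=
  Matrix.of fun x y => k x y • ContinuousLinearMap.id ℝ ℝ

lemma opKernel_posSemidef {X : Type*} {k : X → X → ℝ} (hk : IsKernel k) :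
    (opKernel k).PosSemidef := by
  have key := (RKHS.posSemidef_tfae (𝕜 := ℝ) (K := opKernel k)).out 0 2
  refine key.mpr ⟨?_, fun v => ?_⟩
  · ext x y
    have h1 : star (ContinuousLinearMap.id ℝ ℝ) = ContinuousLinearMap.id ℝ ℝ :=
      star_one (ℝ →L[ℝ] ℝ)
    simp [opKernel, hk.1 x y, Matrix.conjTranspose_apply, h1]
  · have h := hk.2 v.support v
    simp only [Finsupp.sum, opKernel, Matrix.of_apply]
    refine h.trans (le_of_eq ?_)
    simp only [RCLike.re_to_real]
    refine Finset.sum_congr rfl fun x _ => Finset.sum_congr rfl fun y _ => ?_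
    simp [hk.1 x y]
    ring

/-- The closed unit ball of the reproducing kernel Hilbert space of `k`, as a set of functions. -/
noncomputable def unitBall {X : Type*} {k : X → X → ℝ} (hk : IsKernel k) : Set (X → ℝ) :=
  haveI : Fact (opKernel k).PosSemidef := ⟨opKernel_posSemidef hk⟩
  {h | ∃ f : RKHS.OfKernel (opKernel k), ‖f‖ ≤ 1 ∧ (fun x => f x) = h}

/-- The function `√k`, that is `x ↦ √(k x x)`. -/
noncomputable def sqrtDiag {X : Type*} (k : X → X → ℝ) (x : X) : ℝ := √(k x x)

variable {X : Type*} [MeasurableSpace X]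

open Classical in
/-- The maximum mean discrepancy, with values in `[0, ∞]`: the supremum of `|Q h - P h|` over the
`h` in the unit ball of the RKHS whose positive part is `Q`-integrable. If such an `h` is not itself
`Q`-integrable then `Q h = -∞` and the value `|Q h - P h|` is `∞`. The discrepancy is meant for a
`P` that integrates the whole RKHS. -/
noncomputable def mmd {k : X → X → ℝ} (hk : IsKernel k) (Q P : ProbabilityMeasure X) : ℝ≥0∞ :=
  ⨆ h ∈ {h ∈ unitBall hk | Integrable (fun x => max (h x) 0) (Q : Measure X)},
    if Integrable h (Q : Measure X) then
      ENNReal.ofReal |∫ x, h x ∂(Q : Measure X) - ∫ x, h x ∂(P : Measure X)|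
    else ∞

/-- The Bochner-embeddable probability measures: those that integrate `√k`. -/
def bochnerEmbeddable (k : X → X → ℝ) : Set (ProbabilityMeasure X) :=
  {Q | Integrable (sqrtDiag k) (Q : Measure X)}

/-- `k` separates `P` from the set `M` of probability measures. -/
def Separates {k : X → X → ℝ} (hk : IsKernel k) (P : ProbabilityMeasure X)
    (M : Set (ProbabilityMeasure X)) : Prop :=
  ∀ Q ∈ M, mmd hk Q P = 0 → Q = P

/-- Continuous functions `f` for which `f / (1 + g)` is bounded. -/
def growthSpace [TopologicalSpace X] (g : X → ℝ) : Set (X → ℝ) :=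
  {f | Continuous f ∧ ∃ C : ℝ, ∀ x, |f x / (1 + g x)| ≤ C}

/-- `φ` is uniformly integrable by the set `M` of probability measures. -/
def UniformlyIntegrates (M : Set (ProbabilityMeasure X)) (φ : X → ℝ) : Prop :=
  ∀ ε : ℝ≥0∞, 0 < ε → ∃ r : ℝ, 0 < r ∧
    ⨆ μ ∈ M, ∫⁻ x in {x | r < |φ x|}, ENNReal.ofReal |φ x| ∂(μ : Measure X) < ε

/-- `M` is tight. -/
def IsTight [TopologicalSpace X] (M : Set (ProbabilityMeasure X)) : Prop :=
  IsTightMeasureSet ((fun μ : ProbabilityMeasure X => (μ : Measure X)) '' M)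

/-- `k` controls tight `P`-convergence: a tight sequence whose discrepancy to `P` tends to zero
converges weakly to `P`. -/
def ControlsTightConvergence [TopologicalSpace X] [OpensMeasurableSpace X] {k : X → X → ℝ}
    (hk : IsKernel k) (P : ProbabilityMeasure X) : Prop :=
  ∀ Q : ℕ → ProbabilityMeasure X, Tendsto (fun n => mmd hk (Q n) P) atTop (𝓝 0) →
    IsTight (range Q) → Tendsto Q atTop (𝓝 P)

end KernelMMD

/-!
For a Bochner-embeddable measure every function `h` in the unit ball of the RKHS is integrable, since
`|h| ≤ √k`. The theorem rests on the comparison of three modes of convergence `Q n → P`: of the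
integrals of continuous functions of growth at most `1 + √k`, in the discrepancy, and weakly.

Suppose the integrals of all functions of that growth converge. Then `Q n → P` weakly, and Le Cam's
argument (`isTight_range_of_tendsto`) gives tightness without completeness of the space. The integrals
of the excess `max (√k - r) 0` converge too, which is uniform integrability
(`uniformlyIntegrates_of_forall_growthSpace`). The discrepancy tends to zero
(`tendsto_mmd_of_forall_growthSpace`) because the unit ball is equicontinuous for the kernel
distance: a partition of unity on a compact set `S` approximates every `h` in the ball by
`∑ i, c i * h i` with coefficients `c i` independent of `h`, up to a small constant plus `v * √k`,
where `v` vanishes on `S` (`exists_partition`). Both `c i` and `v * √k` are admissible test functions,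
and `∫ v * √k ∂P` is small if `S` nearly carries `√k P`.

Conversely, let `k` separate `P`, and let `Q n` be tight, uniformly integrating `√k`, with discrepancy
to `P` tending to zero. By Prokhorov's theorem `Q` has a weak limit `R` along each ultrafilter finer
than `atTop`. Uniform integrability makes `R` Bochner-embeddable and lets the integrals of functions
of growth `1 + √k` pass to the limit, so `R` and `P` integrate the unit ball alike. Separation gives
`R = P` (`tendsto_of_separates`).

Separation follows from either convergence criterion by applying it to constant sequences. If `k` is
bounded, all measures are Bochner-embeddable and uniform integrability is automatic.
-/

namespace KernelMMD

/-! ### Functions in the unit ball of the RKHS -/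

section RKHS

variable {X : Type*} {k : X → X → ℝ}

/-- The pseudometric `‖k(x, ·) - k(y, ·)‖` that the kernel induces through its feature map. -/
noncomputable def kernelDist (k : X → X → ℝ) (x y : X) : ℝ := √(k x x - 2 * k x y + k y y)

lemma kernelDist_self (k : X → X → ℝ) (x : X) : kernelDist k x x = 0 := by
  simp [kernelDist, two_mul]

lemma sqrtDiag_nonneg (k : X → X → ℝ) (x : X) : 0 ≤ sqrtDiag k x := Real.sqrt_nonneg _

lemma abs_apply_le_of_mem_unitBall (hk : IsKernel k) {h : X → ℝ} (hh : h ∈ unitBall hk) (x : X) :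
    |h x| ≤ sqrtDiag k x := by
  have : Fact (opKernel k).PosSemidef := ⟨opKernel_posSemidef hk⟩
  obtain ⟨f, hf, rfl⟩ := hh
  have hkx : 0 ≤ k x x := by simpa using hk.2 {x} 1
  have h1 := RKHS.norm_apply_le f x
  have h2 : ‖opKernel k x x‖ = k x x := by
    simp [opKernel, norm_smul, abs_of_nonneg hkx]
  rw [RKHS.OfKernel.kernel_ofKernel, h2, Real.norm_eq_abs] at h1
  exact h1.trans (mul_le_of_le_one_left (Real.sqrt_nonneg _) hf)

lemma abs_sub_le_of_mem_unitBall (hk : IsKernel k) {h : X → ℝ} (hh : h ∈ unitBall hk) (x y : X) :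
    |h x - h y| ≤ kernelDist k x y := by
  have : Fact (opKernel k).PosSemidef := ⟨opKernel_posSemidef hk⟩
  obtain ⟨f, hf, rfl⟩ := hh
  set φ : X → RKHS.OfKernel (opKernel k) := fun x => RKHS.kerFun _ x 1 with hφ
  have hval (x : X) : f x = inner ℝ f (φ x) := by
    rw [hφ, RKHS.inner_kerFun]; simp
  have hinner (x y : X) : inner ℝ (φ x) (φ y) = k x y := by
    rw [hφ, ← RKHS.kernel_inner, RKHS.OfKernel.kernel_ofKernel]
    simp [opKernel, hk.1 x y]
  have hdist : ‖φ x - φ y‖ = kernelDist k x y := by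
    rw [kernelDist, ← Real.sqrt_sq (norm_nonneg (φ x - φ y)), norm_sub_sq_real,
      ← real_inner_self_eq_norm_sq, ← real_inner_self_eq_norm_sq, hinner, hinner, hinner]
  change |f x - f y| ≤ _
  rw [hval, hval, ← inner_sub_right, ← hdist]
  exact (abs_real_inner_le_norm _ _).trans (mul_le_of_le_one_left (norm_nonneg _) hf)

variable [TopologicalSpace X]

lemma continuous_sqrtDiag (hc : Continuous fun p : X × X => k p.1 p.2) :
    Continuous (sqrtDiag k) :=
  (hc.comp (continuous_id.prodMk continuous_id)).sqrt

lemma continuous_kernelDist_left (hc : Continuous fun p : X × X => k p.1 p.2) (y : X) :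
    Continuous fun x => kernelDist k x y := by
  have h1 : Continuous fun x => k x x := hc.comp (continuous_id.prodMk continuous_id)
  have h2 : Continuous fun x => k x y := hc.comp (continuous_id.prodMk continuous_const)
  unfold kernelDist
  fun_prop

lemma continuous_of_mem_unitBall (hk : IsKernel k) (hc : Continuous fun p : X × X => k p.1 p.2)
    {h : X → ℝ} (hh : h ∈ unitBall hk) : Continuous h := by
  refine continuous_iff_continuousAt.2 fun x => ?_
  rw [ContinuousAt, tendsto_iff_dist_tendsto_zero]
  have h0 : Tendsto (fun y => kernelDist k y x) (𝓝 x) (𝓝 0) := by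
    simpa [kernelDist_self] using (continuous_kernelDist_left hc x).tendsto x
  exact squeeze_zero (fun _ => dist_nonneg)
    (fun y => by simpa [Real.dist_eq] using abs_sub_le_of_mem_unitBall hk hh y x) h0

/-- Finite-rank approximation of the unit ball of the RKHS on a compact set `S`. The coefficients
`c i` come from a partition of unity subordinate to a cover of `S` by small balls for `kernelDist`;
they do not depend on the function `h`, and the defect `v` of the partition vanishes on `S`. -/
lemma exists_partition (hk : IsKernel k) (hc : Continuous fun p : X × X => k p.1 p.2) {S : Set X}
    (hS : IsCompact S) {ε : ℝ} (hε : 0 < ε) :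
    ∃ (t : Finset X) (c : X → X → ℝ) (v : X → ℝ), (∀ i, Continuous (c i)) ∧ Continuous v ∧
      (∀ i ∈ t, ∀ x, |c i x| ≤ 1) ∧ (∀ x, 0 ≤ v x ∧ v x ≤ 1) ∧ (∀ x ∈ S, v x = 0) ∧
      ∀ h ∈ unitBall hk, ∀ x, |h x - ∑ i ∈ t, c i x * h i| ≤ v x * sqrtDiag k x + 2 * ε := by
  have hd := continuous_kernelDist_left hc
  obtain ⟨t, -, ht⟩ := hS.elim_nhds_subcover (fun y => {x | kernelDist k x y < ε}) fun y _ =>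
    (isOpen_lt (hd y) continuous_const).mem_nhds (by simpa [kernelDist_self] using hε)
  set w : X → X → ℝ := fun i x => max (2 * ε - kernelDist k x i) 0 with hw
  have hw0 (i x : X) : 0 ≤ w i x := le_max_right _ _
  have hwc (i : X) : Continuous (w i) := (continuous_const.sub (hd i)).max continuous_const
  set W : X → ℝ := fun x => ∑ i ∈ t, w i x with hW
  have hWc : Continuous W := continuous_finsetSum _ fun i _ => hwc i
  have hW0 (x : X) : 0 ≤ W x := Finset.sum_nonneg fun i _ => hw0 i x
  set m : X → ℝ := fun x => max (W x) ε with hm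
  have hmc : Continuous m := hWc.max continuous_const
  have hm0 (x : X) : 0 < m x := hε.trans_le (le_max_right _ _)
  have hWm (x : X) : W x / m x ≤ 1 := (div_le_one (hm0 x)).2 (le_max_left _ _)
  have hc0 (i x : X) : 0 ≤ w i x / m x := div_nonneg (hw0 i x) (hm0 x).le
  have hsum (x : X) : ∑ i ∈ t, w i x / m x = W x / m x := (Finset.sum_div _ _ _).symm
  refine ⟨t, fun i x => w i x / m x, fun x => 1 - W x / m x,
    fun i => (hwc i).div hmc fun x => (hm0 x).ne',
    continuous_const.sub (hWc.div hmc fun x => (hm0 x).ne'), fun i hi x => ?_,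
    fun x => ⟨by linarith [hWm x], by linarith [div_nonneg (hW0 x) (hm0 x).le]⟩,
    fun x hx => ?_, fun h hh x => ?_⟩
  · rw [abs_of_nonneg (hc0 i x)]
    refine le_trans ?_ (hWm x)
    rw [← hsum]
    exact Finset.single_le_sum (f := fun i => w i x / m x) (fun i _ => hc0 i x) hi
  · obtain ⟨i, hi, hxi⟩ := mem_iUnion₂.1 (ht hx)
    have hxi' : kernelDist k x i < ε := hxi
    have h1 : ε ≤ W x := calc
      ε ≤ w i x := le_max_of_le_left (by linarith)
      _ ≤ W x := Finset.single_le_sum (f := fun i => w i x) (fun i _ => hw0 i x) hi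
    change 1 - W x / max (W x) ε = 0
    rw [max_eq_left h1, div_self (hε.trans_le h1).ne', sub_self]
  · have hv0 : 0 ≤ 1 - W x / m x := by linarith [hWm x]
    have hterm (i : X) : |w i x / m x * (h x - h i)| ≤ w i x / m x * (2 * ε) := by
      rw [abs_mul, abs_of_nonneg (hc0 i x)]
      -- the weight at `i` vanishes outside the ball of radius `2 * ε` around `i`
      rcases le_or_gt (2 * ε) (kernelDist k x i) with h2 | h2
      · simp [hw, max_eq_right (sub_nonpos.2 h2)]
      · exact mul_le_mul_of_nonneg_left ((abs_sub_le_of_mem_unitBall hk hh x i).trans h2.le)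
          (hc0 i x)
    have hdecomp : h x - ∑ i ∈ t, w i x / m x * h i =
        (1 - W x / m x) * h x + ∑ i ∈ t, w i x / m x * (h x - h i) := by
      simp_rw [mul_sub, Finset.sum_sub_distrib, ← Finset.sum_mul, hsum]
      ring
    rw [hdecomp]
    refine (abs_add_le _ _).trans (add_le_add ?_ ?_)
    · rw [abs_mul, abs_of_nonneg hv0]
      exact mul_le_mul_of_nonneg_left (abs_apply_le_of_mem_unitBall hk hh x) hv0
    · calc |∑ i ∈ t, w i x / m x * (h x - h i)| ≤ ∑ i ∈ t, w i x / m x * (2 * ε) :=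
            (Finset.abs_sum_le_sum_abs _ _).trans (Finset.sum_le_sum fun i _ => hterm i)
        _ = W x / m x * (2 * ε) := by rw [← Finset.sum_mul, hsum]
        _ ≤ 2 * ε := mul_le_of_le_one_left (by positivity) (hWm x)

end RKHS

/-! ### The growth class of a nonnegative function -/

section Growth

variable {X : Type*} [TopologicalSpace X] {u : X → ℝ}

lemma exists_bound_of_mem_growthSpace (hu0 : ∀ x, 0 ≤ u x) {h : X → ℝ} (hh : h ∈ growthSpace u) :
    ∃ C, 0 ≤ C ∧ ∀ x, |h x| ≤ C * (1 + u x) := by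
  obtain ⟨-, C, hC⟩ := hh
  refine ⟨|C|, abs_nonneg _, fun x => ?_⟩
  have hx : 0 < 1 + u x := by linarith [hu0 x]
  have := (hC x).trans (le_abs_self C)
  rwa [abs_div, abs_of_pos hx, div_le_iff₀ hx] at this

lemma mem_growthSpace_of_abs_le (hu0 : ∀ x, 0 ≤ u x) {h : X → ℝ} (hc : Continuous h) {C : ℝ}
    (hC : ∀ x, |h x| ≤ C * (1 + u x)) : h ∈ growthSpace u := by
  refine ⟨hc, C, fun x => ?_⟩
  have hx : 0 < 1 + u x := by linarith [hu0 x]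
  rw [abs_div, abs_of_pos hx, div_le_iff₀ hx]
  exact hC x

variable [MeasurableSpace X] [OpensMeasurableSpace X]

lemma integrable_of_mem_growthSpace (hu0 : ∀ x, 0 ≤ u x) {h : X → ℝ} (hh : h ∈ growthSpace u)
    {μ : Measure X} [IsFiniteMeasure μ] (hu : Integrable u μ) : Integrable h μ := by
  obtain ⟨C, -, hC⟩ := exists_bound_of_mem_growthSpace hu0 hh
  exact (((integrable_const 1).add hu).const_mul C).mono' hh.1.aestronglyMeasurable
    (ae_of_all _ hC)

end Growth

/-! ### Uniform integrability -/

section Excess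

variable {X : Type*} [MeasurableSpace X] {u : X → ℝ} {μ : Measure X}

lemma integrable_max_sub_const (hu0 : ∀ x, 0 ≤ u x) (hu : Integrable u μ) {r : ℝ} (hr : 0 ≤ r) :
    Integrable (fun x => max (u x - r) 0) μ := by
  have hm : AEStronglyMeasurable (fun x => max (u x - r) 0) μ :=
    (hu.1.sub aestronglyMeasurable_const).sup aestronglyMeasurable_const
  refine hu.mono' hm (ae_of_all _ fun x => ?_)
  rw [Real.norm_eq_abs, abs_of_nonneg (le_max_right _ _)]
  exact max_le (by linarith) (hu0 x)

lemma integral_max_sub_const_antitone (hu0 : ∀ x, 0 ≤ u x) (hu : Integrable u μ) {r s : ℝ}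
    (hr : 0 ≤ r) (hrs : r ≤ s) :
    ∫ x, max (u x - s) 0 ∂μ ≤ ∫ x, max (u x - r) 0 ∂μ :=
  integral_mono (integrable_max_sub_const hu0 hu (hr.trans hrs))
    (integrable_max_sub_const hu0 hu hr) fun _ => max_le_max (by linarith) le_rfl

lemma tendsto_integral_max_sub_const (hu0 : ∀ x, 0 ≤ u x) (hu : Integrable u μ) :
    Tendsto (fun r : ℝ => ∫ x, max (u x - r) 0 ∂μ) atTop (𝓝 0) := by
  rw [show 𝓝 (0 : ℝ) = 𝓝 (∫ _, (0 : ℝ) ∂μ) by simp]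
  refine tendsto_integral_filter_of_dominated_convergence u ?_ ?_ hu ?_
  · filter_upwards [eventually_ge_atTop 0] with r hr
    exact (integrable_max_sub_const hu0 hu hr).1
  · filter_upwards [eventually_ge_atTop 0] with r hr
    refine ae_of_all _ fun x => ?_
    rw [Real.norm_eq_abs, abs_of_nonneg (le_max_right _ _)]
    exact max_le (by linarith) (hu0 x)
  · refine ae_of_all _ fun x => tendsto_const_nhds.congr' ?_
    filter_upwards [eventually_ge_atTop (u x)] with r hr
    rw [max_eq_right (by linarith)]

/-- Uniform integrability through the excess `max (u - r) 0` in place of the cut-off `u 1_{u > r}`: the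
excess is dominated by the cut-off at the same level, and it is continuous where `u` is. -/
lemma integral_max_sub_const_lt_of_uniformlyIntegrates {M : Set (ProbabilityMeasure X)}
    (hu0 : ∀ x, 0 ≤ u x) (hum : Measurable u) (hM : ∀ Q ∈ M, Integrable u (Q : Measure X))
    (h : UniformlyIntegrates M u) {ε : ℝ} (hε : 0 < ε) :
    ∀ᶠ r : ℝ in atTop, ∀ Q ∈ M, ∫ x, max (u x - r) 0 ∂(Q : Measure X) < ε := by
  obtain ⟨r, hr, hlt⟩ := h (ENNReal.ofReal ε) (by simpa using hε)
  filter_upwards [eventually_ge_atTop r] with s hs Q hQ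
  refine (integral_max_sub_const_antitone hu0 (hM Q hQ) hr.le hs).trans_lt ?_
  have hS : MeasurableSet {x | r < |u x|} := measurableSet_lt measurable_const hum.abs
  rw [← ENNReal.ofReal_lt_ofReal_iff hε, ofReal_integral_eq_lintegral_ofReal
    (integrable_max_sub_const hu0 (hM Q hQ) hr.le) (ae_of_all _ fun x => le_max_right _ _)]
  refine lt_of_le_of_lt ?_ ((le_iSup₂ (f := fun (μ : ProbabilityMeasure X) (_ : μ ∈ M) =>
    ∫⁻ x in {x | r < |u x|}, ENNReal.ofReal |u x| ∂(μ : Measure X)) Q hQ).trans_lt hlt)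
  rw [← lintegral_indicator hS]
  refine lintegral_mono fun x => ?_
  by_cases hx : r < |u x|
  · rw [indicator_of_mem (show x ∈ {x | r < |u x|} from hx)]
    refine ENNReal.ofReal_le_ofReal (max_le ?_ (abs_nonneg _))
    linarith [le_abs_self (u x)]
  · rw [indicator_of_notMem (show x ∉ {x | r < |u x|} from hx), max_eq_right]
    · simp
    · linarith [le_abs_self (u x)]

/-- The converse comparison: where `u > 2 r`, twice the excess of `u` over `r` dominates `u`. -/
lemma uniformlyIntegrates_of_integral_max_sub_const_lt {M : Set (ProbabilityMeasure X)}
    (hu0 : ∀ x, 0 ≤ u x) (hum : Measurable u) (hM : ∀ Q ∈ M, Integrable u (Q : Measure X))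
    (h : ∀ ε : ℝ, 0 < ε →
      ∀ᶠ r : ℝ in atTop, ∀ Q ∈ M, ∫ x, max (u x - r) 0 ∂(Q : Measure X) < ε) :
    UniformlyIntegrates M u := by
  intro ε hε
  obtain ⟨e, he0, he⟩ := ENNReal.lt_iff_exists_nnreal_btwn.1 hε
  have he0' : (0 : ℝ) < e := by exact_mod_cast he0
  obtain ⟨r, hr, hr0⟩ := ((h (e / 2) (by positivity)).and (eventually_gt_atTop 0)).exists
  refine ⟨2 * r, by positivity, lt_of_le_of_lt (iSup₂_le fun Q hQ => ?_) he⟩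
  have hS : MeasurableSet {x | 2 * r < |u x|} := measurableSet_lt measurable_const hum.abs
  have hint := integrable_max_sub_const hu0 (hM Q hQ) hr0.le
  calc ∫⁻ x in {x | 2 * r < |u x|}, ENNReal.ofReal |u x| ∂(Q : Measure X)
      ≤ ∫⁻ x, ENNReal.ofReal (2 * max (u x - r) 0) ∂(Q : Measure X) := by
        rw [← lintegral_indicator hS]
        refine lintegral_mono fun x => ?_
        by_cases hx : 2 * r < |u x|
        · rw [indicator_of_mem (show x ∈ {x | 2 * r < |u x|} from hx)]
          rw [abs_of_nonneg (hu0 x)] at hx ⊢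
          refine ENNReal.ofReal_le_ofReal ?_
          linarith [le_max_left (u x - r) 0]
        · rw [indicator_of_notMem (show x ∉ {x | 2 * r < |u x|} from hx)]
          exact zero_le
    _ = ENNReal.ofReal (∫ x, 2 * max (u x - r) 0 ∂(Q : Measure X)) :=
        (ofReal_integral_eq_lintegral_ofReal (hint.const_mul 2)
          (ae_of_all _ fun x => by positivity)).symm
    _ ≤ ENNReal.ofReal e := by
        refine ENNReal.ofReal_le_ofReal ?_
        rw [integral_const_mul]
        linarith [hr Q hQ]
    _ = e := ENNReal.ofReal_coe_nnreal

lemma uniformlyIntegrates_of_le {u : X → ℝ} {C : ℝ} (hu : ∀ x, |u x| ≤ C)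
    (M : Set (ProbabilityMeasure X)) : UniformlyIntegrates M u := by
  refine fun ε hε => ⟨max C 1, by positivity, ?_⟩
  have hempty : {x | max C 1 < |u x|} = ∅ :=
    eq_empty_of_forall_notMem fun x hx => absurd ((le_max_left C 1).trans_lt hx) (not_lt.2 (hu x))
  simp only [hempty, Measure.restrict_empty, lintegral_zero_measure]
  simpa using hε

lemma uniformlyIntegrates_singleton {u : X → ℝ} (hu0 : ∀ x, 0 ≤ u x) (hum : Measurable u)
    {Q : ProbabilityMeasure X} (hQ : Integrable u (Q : Measure X)) : UniformlyIntegrates {Q} u :=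
  uniformlyIntegrates_of_integral_max_sub_const_lt hu0 hum (by simpa using hQ)
    fun ε hε => by simpa using (tendsto_integral_max_sub_const hu0 hQ).eventually_lt_const hε

end Excess

/-! ### Weak convergence and unbounded test functions -/

section WeakConvergence

variable {X : Type*} [TopologicalSpace X] [MeasurableSpace X] [OpensMeasurableSpace X] {u : X → ℝ}

lemma tendsto_integral_of_abs_le {ι : Type*} {F : Filter ι} {Q : ι → ProbabilityMeasure X}
    {P : ProbabilityMeasure X} (hQ : Tendsto Q F (𝓝 P)) {h : X → ℝ} (hc : Continuous h) {C : ℝ}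
    (hC : ∀ x, |h x| ≤ C) :
    Tendsto (fun i => ∫ x, h x ∂(Q i : Measure X)) F (𝓝 (∫ x, h x ∂(P : Measure X))) :=
  ProbabilityMeasure.tendsto_iff_forall_integral_tendsto.1 hQ
    (BoundedContinuousFunction.ofNormedAddCommGroup h hc C hC)

lemma tendsto_of_forall_growthSpace (hu0 : ∀ x, 0 ≤ u x) {ι : Type*} {F : Filter ι}
    {Q : ι → ProbabilityMeasure X} {P : ProbabilityMeasure X}
    (h : ∀ h ∈ growthSpace u,
      Tendsto (fun i => ∫ x, h x ∂(Q i : Measure X)) F (𝓝 (∫ x, h x ∂(P : Measure X)))) :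
    Tendsto Q F (𝓝 P) := by
  refine ProbabilityMeasure.tendsto_iff_forall_integral_tendsto.2 fun f => h f ?_
  refine mem_growthSpace_of_abs_le hu0 f.continuous (C := ‖f‖) fun x => ?_
  exact (f.norm_coe_le_norm x).trans
    (le_mul_of_one_le_right (norm_nonneg _) (by linarith [hu0 x]))

/-- A weak limit of measures that uniformly integrate `u` integrates `u`: the truncations `min u n`
have integrals bounded independently of `n`. -/
lemma integrable_of_tendsto {ι : Type*} {F : Filter ι} [F.NeBot]
    {Q : ι → ProbabilityMeasure X} {P : ProbabilityMeasure X} (hQ : Tendsto Q F (𝓝 P))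
    (hu0 : ∀ x, 0 ≤ u x) (huc : Continuous u) (hQu : ∀ i, Integrable u (Q i : Measure X))
    (hui : ∀ ε : ℝ, 0 < ε →
      ∀ᶠ r : ℝ in atTop, ∀ i, ∫ x, max (u x - r) 0 ∂(Q i : Measure X) < ε) :
    Integrable u (P : Measure X) := by
  obtain ⟨r, hr, hr0⟩ := ((hui 1 one_pos).and (eventually_ge_atTop 0)).exists
  have hbound (i : ι) : ∫ x, u x ∂(Q i : Measure X) ≤ r + 1 := by
    have hint := integrable_max_sub_const hu0 (hQu i) hr0
    calc ∫ x, u x ∂(Q i : Measure X) ≤ ∫ x, (r + max (u x - r) 0) ∂(Q i : Measure X) :=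
          integral_mono (hQu i) ((integrable_const r).add hint)
            fun x => by linarith [le_max_left (u x - r) 0]
      _ = r + ∫ x, max (u x - r) 0 ∂(Q i : Measure X) := by
          rw [integral_add (integrable_const r) hint]; simp
      _ ≤ r + 1 := by linarith [hr i]
  have habs (n : ℕ) (x : X) : |min (u x) n| ≤ n := by
    rw [abs_of_nonneg (le_min (hu0 x) n.cast_nonneg)]
    exact min_le_right _ _
  have hmc (n : ℕ) : Continuous fun x => min (u x) (n : ℝ) := huc.min continuous_const
  have hmi (n : ℕ) (R : ProbabilityMeasure X) :
      Integrable (fun x => min (u x) (n : ℝ)) (R : Measure X) :=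
    (integrable_const (n : ℝ)).mono' (hmc n).aestronglyMeasurable (ae_of_all _ (habs n))
  have htrunc (n : ℕ) : ∫ x, min (u x) n ∂(P : Measure X) ≤ r + 1 :=
    le_of_tendsto (tendsto_integral_of_abs_le hQ (hmc n) (habs n)) (Eventually.of_forall fun i =>
      (integral_mono (hmi n (Q i)) (hQu i) fun x => min_le_left _ _).trans (hbound i))
  have hsup (x : X) : ENNReal.ofReal (u x) = ⨆ n : ℕ, ENNReal.ofReal (min (u x) n) := by
    refine le_antisymm ?_ (iSup_le fun n => ENNReal.ofReal_le_ofReal (min_le_left _ _))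
    obtain ⟨n, hn⟩ := exists_nat_ge (u x)
    exact le_iSup_of_le n (by rw [min_eq_left hn])
  refine ⟨huc.aestronglyMeasurable, ?_⟩
  rw [hasFiniteIntegral_iff_ofReal (ae_of_all _ hu0)]
  calc ∫⁻ x, ENNReal.ofReal (u x) ∂(P : Measure X)
      = ⨆ n : ℕ, ∫⁻ x, ENNReal.ofReal (min (u x) n) ∂(P : Measure X) := by
        simp_rw [hsup]
        refine lintegral_iSup (fun n => (hmc n).measurable.ennreal_ofReal) fun m n hmn x => ?_
        exact ENNReal.ofReal_le_ofReal (min_le_min_left _ (by exact_mod_cast hmn))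
    _ ≤ ENNReal.ofReal (r + 1) := iSup_le fun n => by
        rw [← ofReal_integral_eq_lintegral_ofReal (hmi n P)
          (ae_of_all _ fun x => le_min (hu0 x) n.cast_nonneg)]
        exact ENNReal.ofReal_le_ofReal (htrunc n)
    _ < ∞ := ENNReal.ofReal_lt_top

/-- Weak convergence and uniform integrability of `u` give convergence of the integrals of all
continuous functions of growth at most `1 + u`. -/
lemma tendsto_integral_of_mem_growthSpace {ι : Type*} {F : Filter ι} [F.NeBot]
    {Q : ι → ProbabilityMeasure X} {P : ProbabilityMeasure X} (hQ : Tendsto Q F (𝓝 P))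
    (hu0 : ∀ x, 0 ≤ u x) (huc : Continuous u) (hQu : ∀ i, Integrable u (Q i : Measure X))
    (hui : ∀ ε : ℝ, 0 < ε →
      ∀ᶠ r : ℝ in atTop, ∀ i, ∫ x, max (u x - r) 0 ∂(Q i : Measure X) < ε)
    {h : X → ℝ} (hh : h ∈ growthSpace u) :
    Tendsto (fun i => ∫ x, h x ∂(Q i : Measure X)) F (𝓝 (∫ x, h x ∂(P : Measure X))) := by
  have hPu := integrable_of_tendsto hQ hu0 huc hQu hui
  obtain ⟨C, hC0, hC⟩ := exists_bound_of_mem_growthSpace hu0 hh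
  rw [Metric.tendsto_nhds]
  intro ε hε
  have hδ : 0 < ε / (3 * (C + 1)) := by positivity
  obtain ⟨r, ⟨hrQ, hrP⟩, hr0⟩ := (((hui _ hδ).and
    ((tendsto_integral_max_sub_const hu0 hPu).eventually_lt_const hδ)).and
      (eventually_ge_atTop 0)).exists
  set B := C * (1 + r) with hB
  have hB0 : 0 ≤ B := by positivity
  set g : X → ℝ := fun x => max (-B) (min (h x) B) with hg
  have hgc : Continuous g := continuous_const.max (hh.1.min continuous_const)
  have hgB (x : X) : |g x| ≤ B :=
    abs_le.2 ⟨le_max_left _ _, max_le (by linarith) (min_le_right _ _)⟩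
  have hhg (x : X) : |h x - g x| ≤ C * max (u x - r) 0 := by
    have h0 : 0 ≤ C * max (u x - r) 0 := by positivity
    have h1 : C * (u x - r) ≤ C * max (u x - r) 0 :=
      mul_le_mul_of_nonneg_left (le_max_left _ _) hC0
    have h2 := abs_le.1 (hC x)
    have h3 : C * (1 + u x) = B + C * (u x - r) := by rw [hB]; ring
    rw [hg, abs_le]
    rcases le_total (h x) B with h4 | h4
    · rcases le_total (-B) (h x) with h5 | h5
      · simp only [min_eq_left h4, max_eq_right h5]
        constructor <;> linarith
      · simp only [min_eq_left h4, max_eq_left h5]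
        constructor <;> linarith
    · simp only [min_eq_right h4, max_eq_right (show -B ≤ B by linarith)]
      constructor <;> linarith
  -- replacing `h` by its truncation `g` costs at most `C` times the excess of `u` over `r`
  have herr (R : ProbabilityMeasure X) (hRu : Integrable u (R : Measure X))
      (hR : ∫ x, max (u x - r) 0 ∂(R : Measure X) < ε / (3 * (C + 1))) :
      |∫ x, h x ∂(R : Measure X) - ∫ x, g x ∂(R : Measure X)| ≤ ε / 3 := by
    have hhi := integrable_of_mem_growthSpace hu0 hh hRu
    have hgi : Integrable g (R : Measure X) :=
      (integrable_const B).mono' hgc.aestronglyMeasurable (ae_of_all _ hgB)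
    rw [← integral_sub hhi hgi]
    calc |∫ x, (h x - g x) ∂(R : Measure X)| ≤ ∫ x, |h x - g x| ∂(R : Measure X) :=
          abs_integral_le_integral_abs
      _ ≤ ∫ x, C * max (u x - r) 0 ∂(R : Measure X) :=
          integral_mono (hhi.sub hgi).abs ((integrable_max_sub_const hu0 hRu hr0).const_mul C) hhg
      _ = C * ∫ x, max (u x - r) 0 ∂(R : Measure X) := integral_const_mul _ _
      _ ≤ (C + 1) * (ε / (3 * (C + 1))) :=
          mul_le_mul (by linarith) hR.le (integral_nonneg fun x => le_max_right _ _) (by linarith)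
      _ = ε / 3 := by field_simp
  filter_upwards [Metric.tendsto_nhds.1 (tendsto_integral_of_abs_le hQ hgc hgB) (ε / 3)
    (by positivity)] with i hi
  rw [Real.dist_eq] at hi ⊢
  have h1 := abs_le.1 (herr (Q i) (hQu i) (hrQ i))
  have h2 := abs_le.1 (herr P hPu hrP)
  have h3 := abs_lt.1 hi
  rw [abs_lt]
  constructor <;> linarith [h1.1, h1.2, h2.1, h2.2, h3.1, h3.2]

/-- If the integrals of all functions of growth at most `1 + u` converge along a sequence, then the
sequence uniformly integrates `u`, because the excess of `u` over a level belongs to that class. -/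
lemma uniformlyIntegrates_of_forall_growthSpace (hu0 : ∀ x, 0 ≤ u x) (huc : Continuous u)
    {Q : ℕ → ProbabilityMeasure X} {P : ProbabilityMeasure X}
    (hQu : ∀ n, Integrable u (Q n : Measure X)) (hPu : Integrable u (P : Measure X))
    (h : ∀ h ∈ growthSpace u,
      Tendsto (fun n => ∫ x, h x ∂(Q n : Measure X)) atTop (𝓝 (∫ x, h x ∂(P : Measure X)))) :
    UniformlyIntegrates (range Q) u := by
  refine uniformlyIntegrates_of_integral_max_sub_const_lt hu0 huc.measurable
    (by rintro _ ⟨n, rfl⟩; exact hQu n) fun ε hε => ?_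
  obtain ⟨r, hrP, hr0⟩ := (((tendsto_integral_max_sub_const hu0 hPu).eventually_lt_const hε).and
    (eventually_ge_atTop 0)).exists
  have hmem : (fun x => max (u x - r) 0) ∈ growthSpace u := by
    refine mem_growthSpace_of_abs_le hu0 (by fun_prop) (C := 1) fun x => ?_
    rw [abs_of_nonneg (le_max_right _ _)]
    exact max_le (by linarith) (by linarith [hu0 x])
  obtain ⟨N, hN⟩ := eventually_atTop.1 ((h _ hmem).eventually_lt_const hrP)
  have hfin : ∀ᶠ s : ℝ in atTop, ∀ n ∈ Finset.range N,
      ∫ x, max (u x - s) 0 ∂(Q n : Measure X) < ε :=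
    (Finset.eventually_all _).2 fun n _ =>
      (tendsto_integral_max_sub_const hu0 (hQu n)).eventually_lt_const hε
  filter_upwards [hfin, eventually_ge_atTop r] with s hs hrs
  rintro _ ⟨n, rfl⟩
  rcases lt_or_ge n N with hn | hn
  · exact hs n (Finset.mem_range.2 hn)
  · exact (integral_max_sub_const_antitone hu0 (hQu n) hr0 hrs).trans_lt (hN n hn)

end WeakConvergence

/-! ### Tightness of weakly convergent sequences -/

section Tightness

/-- Compact sets that accumulate only at a compact set have, together with it, a compact union. -/
lemma isCompact_union_iUnion {X : Type*} [TopologicalSpace X] {K : Set X} (hK : IsCompact K)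
    {L : ℕ → Set X} (hL : ∀ n, IsCompact (L n))
    (hKL : ∀ U, IsOpen U → K ⊆ U → ∀ᶠ n in atTop, L n ⊆ U) : IsCompact (K ∪ ⋃ n, L n) := by
  classical
  refine isCompact_of_finite_subcover fun {ι} U hU hcov => ?_
  obtain ⟨s, hs⟩ := hK.elim_finite_subcover U hU (subset_union_left.trans hcov)
  obtain ⟨N, hN⟩ := eventually_atTop.1 (hKL _ (isOpen_biUnion fun i (_ : i ∈ s) => hU i) hs)
  obtain ⟨t, ht⟩ := ((finite_lt_nat N).isCompact_biUnion fun n _ => hL n).elim_finite_subcover U hU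
    ((iUnion₂_subset fun n _ => subset_iUnion L n).trans (subset_union_right.trans hcov))
  refine ⟨s ∪ t, ?_⟩
  rw [Finset.set_biUnion_union]
  refine union_subset (hs.trans subset_union_left) (iUnion_subset fun n => ?_)
  rcases lt_or_ge n N with hn | hn
  · exact (subset_biUnion_of_mem (u := L) (show n ∈ {n | n < N} from hn)).trans
      (ht.trans subset_union_right)
  · exact (hN n hn).trans subset_union_left

variable {X : Type*} [MeasurableSpace X]

lemma isTight_iff [TopologicalSpace X] {M : Set (ProbabilityMeasure X)} :
    IsTight M ↔ ∀ ε : ℝ≥0∞, 0 < ε →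
      ∃ K : Set X, IsCompact K ∧ ∀ Q ∈ M, (Q : Measure X) Kᶜ ≤ ε := by
  simp [IsTight, isTightMeasureSet_iff_exists_isCompact_measure_compl_le]

lemma isTight_singleton [TopologicalSpace X] (hX : IsRadonSpace X) (P : ProbabilityMeasure X) :
    IsTight {P} := by
  refine isTight_iff.2 fun ε hε => ?_
  obtain ⟨K, -, hK, hPK⟩ := hX P inferInstance univ .univ ε hε
  exact ⟨K, hK, by simpa [compl_eq_univ_sdiff] using hPK⟩

/-- **Le Cam's theorem**: in a metric Radon space, a weakly convergent sequence is tight. No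
completeness is needed: a compact set `K` that nearly carries the limit has neighbourhoods
`T m` shrinking to it, the `n`-th measure is nearly carried by `T m` for some `m = m(n)` tending to
infinity, and hence by a compact subset of it. These compact sets accumulate only at `K`. -/
lemma isTight_range_of_tendsto [PseudoMetricSpace X] [OpensMeasurableSpace X]
    (hX : IsRadonSpace X) {Q : ℕ → ProbabilityMeasure X} {P : ProbabilityMeasure X}
    (hQ : Tendsto Q atTop (𝓝 P)) : IsTight (range Q) := by
  classical
  refine isTight_iff.2 fun ε hε => ?_
  wlog hε' : ε ≠ ∞ generalizing ε
  · obtain ⟨K, hK, h⟩ := this 1 one_pos ENNReal.one_ne_top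
    exact ⟨K, hK, fun R hR => (h R hR).trans (by simp [not_not.1 hε'])⟩
  have hε2 : 0 < ε / 2 := ENNReal.half_pos hε.ne'
  have hε4 : ε / 2 / 2 < ε / 2 := ENNReal.half_lt_self hε2.ne' (ENNReal.div_ne_top hε' (by simp))
  obtain ⟨K, -, hK, hPK⟩ := hX P inferInstance univ .univ (ε / 2 / 2) (ENNReal.half_pos hε2.ne')
  rw [← compl_eq_univ_sdiff] at hPK
  -- for `m ≥ 1` this is the open `1 / m`-thickening of `K`, while `T 0` is the whole space
  set T : ℕ → Set X := fun m => {x | m * Metric.infEDist x K < 1} with hT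
  have hTo (m : ℕ) : IsOpen (T m) :=
    isOpen_lt ((ENNReal.continuous_const_mul (by simp)).comp Metric.continuous_infEDist)
      continuous_const
  have hKT (m : ℕ) : K ⊆ T m := fun x hx => by simp [hT, Metric.infEDist_zero_of_mem hx]
  have hev (m : ℕ) : ∀ᶠ n in atTop, (Q n : Measure X) (T m)ᶜ ≤ ε / 2 := by
    have h1 := ProbabilityMeasure.limsup_measure_closed_le_of_tendsto hQ (hTo m).isClosed_compl
    have h2 := (h1.trans (measure_mono (compl_subset_compl.2 (hKT m)))).trans hPK
    exact (eventually_lt_of_limsup_lt (h2.trans_lt hε4)).mono fun _ h => h.le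
  set good : ℕ → ℕ → Prop := fun n m => (Q n : Measure X) (T m)ᶜ ≤ ε / 2 with hgood
  set m : ℕ → ℕ := fun n => Nat.findGreatest (good n) n with hm
  have hm_good (n : ℕ) : good n (m n) :=
    Nat.findGreatest_spec (P := good n) (Nat.zero_le n) (by simp [hgood, hT])
  choose L hLT hL hQL using fun n =>
    hX (Q n) inferInstance (T (m n)) (hTo _).measurableSet (ε / 2) hε2
  refine ⟨K ∪ ⋃ n, L n, isCompact_union_iUnion hK hL fun U hU hKU => ?_, ?_⟩
  · obtain ⟨δ, hδ, hδU⟩ := hK.exists_thickening_subset_open hU hKU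
    obtain ⟨j, hj⟩ := exists_nat_gt δ⁻¹
    have hj0 : (0 : ℝ) < j := (inv_pos.2 hδ).trans hj
    filter_upwards [hev j, eventually_ge_atTop j] with n hn hjn
    have hjm : j ≤ m n := Nat.le_findGreatest hjn hn
    refine (hLT n).trans (Subset.trans (fun x hx => ?_) hδU)
    rw [Metric.mem_thickening_iff_infEDist_lt]
    have hx' : (j : ℝ≥0∞) * Metric.infEDist x K < 1 := by
      refine lt_of_le_of_lt ?_ (show (m n : ℝ≥0∞) * Metric.infEDist x K < 1 from hx)
      gcongr
    by_contra hlt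
    have h1 : (1 : ℝ≥0∞) ≤ j * ENNReal.ofReal δ := by
      rw [← ENNReal.ofReal_natCast, ← ENNReal.ofReal_mul hj0.le, ← ENNReal.ofReal_one]
      refine ENNReal.ofReal_le_ofReal ?_
      have := mul_lt_mul_of_pos_right hj hδ
      rw [inv_mul_cancel₀ hδ.ne'] at this
      exact this.le
    refine absurd (h1.trans ?_) (not_le.2 hx')
    gcongr
    exact not_lt.1 hlt
  · rintro _ ⟨n, rfl⟩
    calc (Q n : Measure X) (K ∪ ⋃ n, L n)ᶜ ≤ (Q n : Measure X) ((T (m n))ᶜ ∪ (T (m n) \ L n)) := by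
          refine measure_mono fun x hx => ?_
          by_cases hxT : x ∈ T (m n)
          · exact Or.inr ⟨hxT, fun hxL => hx (Or.inr (mem_iUnion.2 ⟨n, hxL⟩))⟩
          · exact Or.inl hxT
      _ ≤ ε / 2 + ε / 2 := (measure_union_le _ _).trans (add_le_add (hm_good n) (hQL n))
      _ = ε := ENNReal.add_halves ε

lemma exists_isCompact_setIntegral_compl_lt [TopologicalSpace X] {P : ProbabilityMeasure X}
    (hP : IsTight {P}) {u : X → ℝ} (hu0 : ∀ x, 0 ≤ u x) (hPu : Integrable u (P : Measure X))
    {ε : ℝ} (hε : 0 < ε) : ∃ S : Set X, IsCompact S ∧ ∫ x in Sᶜ, u x ∂(P : Measure X) < ε := by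
  have hfin : ∫⁻ x, ENNReal.ofReal (u x) ∂(P : Measure X) ≠ ∞ :=
    ((hasFiniteIntegral_iff_ofReal (ae_of_all _ hu0)).1 hPu.2).ne
  obtain ⟨δ, hδ, h⟩ := exists_pos_setLIntegral_lt_of_measure_lt hfin
    (ε := ENNReal.ofReal ε) (by simpa using hε)
  obtain ⟨δ', hδ'0, hδ'⟩ := exists_between hδ
  obtain ⟨S, hS, hPS⟩ := isTight_iff.1 hP δ' hδ'0
  refine ⟨S, hS, ?_⟩
  rw [← ENNReal.ofReal_lt_ofReal_iff hε,
    ofReal_integral_eq_lintegral_ofReal hPu.integrableOn (ae_of_all _ hu0)]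
  exact h _ ((hPS P rfl).trans_lt hδ')

end Tightness

/-! ### The discrepancy between Bochner-embeddable measures -/

section Discrepancy

variable {X : Type*} [TopologicalSpace X] [MeasurableSpace X] [OpensMeasurableSpace X]
  {k : X → X → ℝ}

lemma integrable_of_mem_unitBall (hk : IsKernel k) (hc : Continuous fun p : X × X => k p.1 p.2)
    {h : X → ℝ} (hh : h ∈ unitBall hk) {Q : ProbabilityMeasure X} (hQ : Q ∈ bochnerEmbeddable k) :
    Integrable h (Q : Measure X) :=
  hQ.mono' (continuous_of_mem_unitBall hk hc hh).aestronglyMeasurable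
    (ae_of_all _ (abs_apply_le_of_mem_unitBall hk hh))

/-- For a Bochner-embeddable `Q` every function in the unit ball is `Q`-integrable, so the constraint
and the value `∞` in the definition of `mmd` play no role. -/
lemma mmd_le_iff (hk : IsKernel k) (hc : Continuous fun p : X × X => k p.1 p.2)
    {Q P : ProbabilityMeasure X} (hQ : Q ∈ bochnerEmbeddable k) {c : ℝ≥0∞} :
    mmd hk Q P ≤ c ↔ ∀ h ∈ unitBall hk,
      ENNReal.ofReal |∫ x, h x ∂(Q : Measure X) - ∫ x, h x ∂(P : Measure X)| ≤ c := by
  rw [mmd, iSup₂_le_iff]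
  refine ⟨fun H h hh => ?_, fun H h hh => ?_⟩
  · have hi := integrable_of_mem_unitBall hk hc hh hQ
    simpa [hi] using H h ⟨hh, hi.pos_part⟩
  · rw [if_pos (integrable_of_mem_unitBall hk hc hh.1 hQ)]
    exact H h hh.1

lemma tendsto_integral_of_tendsto_mmd (hk : IsKernel k)
    (hc : Continuous fun p : X × X => k p.1 p.2) {ι : Type*} {F : Filter ι} [F.NeBot]
    {Q : ι → ProbabilityMeasure X} {P : ProbabilityMeasure X}
    (hQ : ∀ i, Q i ∈ bochnerEmbeddable k) (hmmd : Tendsto (fun i => mmd hk (Q i) P) F (𝓝 0))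
    {h : X → ℝ} (hh : h ∈ unitBall hk) :
    Tendsto (fun i => ∫ x, h x ∂(Q i : Measure X)) F (𝓝 (∫ x, h x ∂(P : Measure X))) := by
  have h1 : Tendsto (fun i => ENNReal.ofReal
      |∫ x, h x ∂(Q i : Measure X) - ∫ x, h x ∂(P : Measure X)|) F (𝓝 0) :=
    tendsto_of_tendsto_of_tendsto_of_le_of_le tendsto_const_nhds hmmd (fun _ => zero_le)
      fun i => (mmd_le_iff hk hc (hQ i)).1 le_rfl h hh
  have h2 := (ENNReal.tendsto_toReal ENNReal.zero_ne_top).comp h1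
  rw [tendsto_iff_dist_tendsto_zero]
  refine h2.congr fun i => ?_
  rw [Function.comp_apply, ENNReal.toReal_ofReal (abs_nonneg _), Real.dist_eq]

/-- The mean embedding is continuous for convergence of the integrals of all functions of growth at
most `1 + √k`. -/
lemma tendsto_mmd_of_forall_growthSpace [T2Space X] (hk : IsKernel k)
    (hc : Continuous fun p : X × X => k p.1 p.2) {ι : Type*} {F : Filter ι}
    {Q : ι → ProbabilityMeasure X} {P : ProbabilityMeasure X}
    (hQ : ∀ i, Q i ∈ bochnerEmbeddable k) (hP : P ∈ bochnerEmbeddable k) (hPt : IsTight {P})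
    (h : ∀ h ∈ growthSpace (sqrtDiag k),
      Tendsto (fun i => ∫ x, h x ∂(Q i : Measure X)) F (𝓝 (∫ x, h x ∂(P : Measure X)))) :
    Tendsto (fun i => mmd hk (Q i) P) F (𝓝 0) := by
  set u := sqrtDiag k with hu
  have hu0 : ∀ x, 0 ≤ u x := sqrtDiag_nonneg k
  have huc : Continuous u := continuous_sqrtDiag hc
  -- it suffices to bound the discrepancy by `7 ε` eventually
  suffices H : ∀ ε : ℝ, 0 < ε → ∀ᶠ i in F, mmd hk (Q i) P ≤ ENNReal.ofReal (7 * ε) by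
    rw [ENNReal.tendsto_nhds_zero]
    intro e he
    obtain ⟨e', he'0, he'⟩ := ENNReal.lt_iff_exists_nnreal_btwn.1 he
    have he'0' : (0 : ℝ) < e' := by exact_mod_cast he'0
    filter_upwards [H (e' / 7) (by positivity)] with i hi
    rw [mul_div_cancel₀ _ (by norm_num), ENNReal.ofReal_coe_nnreal] at hi
    exact hi.trans he'.le
  intro ε hε
  obtain ⟨S, hS, hSP⟩ := exists_isCompact_setIntegral_compl_lt hPt hu0 hP hε
  obtain ⟨t, c, v, hcc, hvc, hc1, hv, hvS, happrox⟩ := exists_partition hk hc hS hε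
  have hvu : (fun x => v x * u x) ∈ growthSpace u := by
    refine mem_growthSpace_of_abs_le hu0 (hvc.mul huc) (C := 1) fun x => ?_
    rw [abs_of_nonneg (mul_nonneg (hv x).1 (hu0 x))]
    linarith [mul_le_of_le_one_left (hu0 x) (hv x).2]
  have hcg (i : X) (hi : i ∈ t) : c i ∈ growthSpace u :=
    mem_growthSpace_of_abs_le hu0 (hcc i) (C := 1) fun x => by linarith [hc1 i hi x, hu0 x]
  have hPvu : ∫ x, v x * u x ∂(P : Measure X) < ε := by
    refine lt_of_le_of_lt ?_ hSP
    rw [← integral_indicator hS.measurableSet.compl]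
    refine integral_mono (integrable_of_mem_growthSpace hu0 hvu hP)
      (hP.indicator hS.measurableSet.compl) fun x => ?_
    by_cases hx : x ∈ S
    · simp [hvS x hx, hx]
    · rw [indicator_of_mem (show x ∈ Sᶜ from hx)]
      exact mul_le_of_le_one_left (hu0 x) (hv x).2
  have hsum : Tendsto (fun i => ∑ j ∈ t,
      |∫ x, c j x ∂(Q i : Measure X) - ∫ x, c j x ∂(P : Measure X)| * u j) F (𝓝 0) := by
    rw [show 𝓝 (0 : ℝ) = 𝓝 (∑ j ∈ t, 0 * u j) by simp]
    refine tendsto_finsetSum _ fun j hj => Tendsto.mul_const _ ?_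
    simpa [Real.dist_eq] using tendsto_iff_dist_tendsto_zero.1 (h _ (hcg j hj))
  filter_upwards [(h _ hvu).eventually_lt_const hPvu, hsum.eventually_lt_const hε] with i hi1 hi2
  refine (mmd_le_iff hk hc (hQ i)).2 fun f hf => ENNReal.ofReal_le_ofReal ?_
  have hrank (R : ProbabilityMeasure X) (hR : R ∈ bochnerEmbeddable k) :
      |∫ x, f x ∂(R : Measure X) - ∑ j ∈ t, (∫ x, c j x ∂(R : Measure X)) * f j| ≤
        ∫ x, v x * u x ∂(R : Measure X) + 2 * ε := by
    have hci (j : X) (hj : j ∈ t) : Integrable (fun x => c j x * f j) (R : Measure X) :=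
      (integrable_of_mem_growthSpace hu0 (hcg j hj) hR).mul_const _
    have hfi := integrable_of_mem_unitBall hk hc hf hR
    have hvi := integrable_of_mem_growthSpace hu0 hvu hR
    simp_rw [← integral_mul_const]
    rw [← integral_finsetSum _ hci, ← integral_sub hfi (integrable_finsetSum _ hci)]
    calc |∫ x, (f x - ∑ j ∈ t, c j x * f j) ∂(R : Measure X)|
        ≤ ∫ x, |f x - ∑ j ∈ t, c j x * f j| ∂(R : Measure X) := abs_integral_le_integral_abs
      _ ≤ ∫ x, (v x * u x + 2 * ε) ∂(R : Measure X) :=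
          integral_mono (hfi.sub (integrable_finsetSum _ hci)).abs
            (hvi.add (integrable_const _)) (happrox f hf)
      _ = ∫ x, v x * u x ∂(R : Measure X) + 2 * ε := by
          rw [integral_add hvi (integrable_const _)]; simp
  have hdiff : |∑ j ∈ t, (∫ x, c j x ∂(Q i : Measure X)) * f j -
      ∑ j ∈ t, (∫ x, c j x ∂(P : Measure X)) * f j| ≤
      ∑ j ∈ t, |∫ x, c j x ∂(Q i : Measure X) - ∫ x, c j x ∂(P : Measure X)| * u j := by
    rw [← Finset.sum_sub_distrib]
    refine (Finset.abs_sum_le_sum_abs _ _).trans (Finset.sum_le_sum fun j _ => ?_)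
    rw [← sub_mul, abs_mul]
    exact mul_le_mul_of_nonneg_left (abs_apply_le_of_mem_unitBall hk hf j) (abs_nonneg _)
  have h1 := abs_le.1 (hrank (Q i) (hQ i))
  have h2 := abs_le.1 (hrank P hP)
  have h3 := abs_le.1 hdiff
  rw [abs_le]
  constructor <;> linarith [h1.1, h1.2, h2.1, h2.2, h3.1, h3.2]

/-- If `k` separates `P` from the Bochner-embeddable measures, then a tight sequence that uniformly
integrates `√k` and whose discrepancy to `P` tends to zero converges to `P`: by Prokhorov's theorem
it has a weak limit along every ultrafilter, and each such limit has discrepancy zero to `P`. -/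
lemma tendsto_of_separates [T2Space X] [BorelSpace X] [HasOuterApproxClosed X] (hk : IsKernel k)
    (hc : Continuous fun p : X × X => k p.1 p.2) {P : ProbabilityMeasure X}
    (hsep : Separates hk P (bochnerEmbeddable k))
    {Q : ℕ → ProbabilityMeasure X} (hQ : ∀ n, Q n ∈ bochnerEmbeddable k)
    (hmmd : Tendsto (fun n => mmd hk (Q n) P) atTop (𝓝 0)) (htight : IsTight (range Q))
    (hui : UniformlyIntegrates (range Q) (sqrtDiag k)) : Tendsto Q atTop (𝓝 P) := by
  have hu0 := sqrtDiag_nonneg k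
  have huc := continuous_sqrtDiag hc
  have hui' (ε : ℝ) (hε : 0 < ε) : ∀ᶠ r : ℝ in atTop, ∀ n,
      ∫ x, max (sqrtDiag k x - r) 0 ∂(Q n : Measure X) < ε :=
    (integral_max_sub_const_lt_of_uniformlyIntegrates hu0 huc.measurable
      (by rintro _ ⟨n, rfl⟩; exact hQ n) hui hε).mono fun r hr n => hr _ (mem_range_self n)
  refine (tendsto_iff_ultrafilter _ _ _).2 fun U hU => ?_
  obtain ⟨R, -, hR⟩ := (isCompact_closure_of_isTightMeasureSet htight).ultrafilter_le_nhds (U.map Q)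
    (le_principal_iff.2 (Filter.mem_map.2 (univ_mem'
      fun n => subset_closure (mem_range_self n))))
  have hR' : Tendsto Q U (𝓝 R) := hR
  have hRk : R ∈ bochnerEmbeddable k := integrable_of_tendsto hR' hu0 huc hQ hui'
  have hRP : R = P := by
    refine hsep R hRk ?_
    rw [← nonpos_iff_eq_zero, mmd_le_iff hk hc hRk]
    intro h hh
    have hg : h ∈ growthSpace (sqrtDiag k) :=
      mem_growthSpace_of_abs_le hu0 (continuous_of_mem_unitBall hk hc hh) (C := 1) fun x => by
        linarith [abs_apply_le_of_mem_unitBall hk hh x]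
    rw [tendsto_nhds_unique (tendsto_integral_of_mem_growthSpace hR' hu0 huc hQ hui' hg)
      (tendsto_integral_of_tendsto_mmd hk hc hQ (hmmd.mono_left hU) hh)]
    simp
  rwa [hRP] at hR'

end Discrepancy

end KernelMMD

theorem mainTheorem1 {X : Type*} [MetricSpace X] [TopologicalSpace.SeparableSpace X]
    [MeasurableSpace X] [BorelSpace X] (hX : KernelMMD.IsRadonSpace X)
    (k : X → X → ℝ) (hk : KernelMMD.IsKernel k) (hk_cont : Continuous fun p : X × X => k p.1 p.2)
    (P : ProbabilityMeasure X) (hP : P ∈ KernelMMD.bochnerEmbeddable k) :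
    (KernelMMD.Separates hk P (KernelMMD.bochnerEmbeddable k) ↔
      ∀ Q : ℕ → ProbabilityMeasure X, (∀ n, Q n ∈ KernelMMD.bochnerEmbeddable k) →
        ((∀ h ∈ KernelMMD.growthSpace (KernelMMD.sqrtDiag k),
            Tendsto (fun n => ∫ x, h x ∂(Q n : Measure X)) atTop
              (𝓝 (∫ x, h x ∂(P : Measure X)))) ↔
          (Tendsto (fun n => KernelMMD.mmd hk (Q n) P) atTop (𝓝 0) ∧
            KernelMMD.IsTight (range Q) ∧
            KernelMMD.UniformlyIntegrates (range Q) (KernelMMD.sqrtDiag k)))) ∧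
    ((∃ C : ℝ, ∀ x y, |k x y| ≤ C) →
      (KernelMMD.Separates hk P univ ↔ KernelMMD.ControlsTightConvergence hk P)) := by
  have hu0 := KernelMMD.sqrtDiag_nonneg k
  have huc := KernelMMD.continuous_sqrtDiag hk_cont
  refine ⟨⟨fun hsep Q hQ => ⟨fun h => ?_, fun ⟨hmmd, htight, hui⟩ f hf => ?_⟩, fun H Q hQ hQP => ?_⟩,
    fun ⟨C, hC⟩ => ?_⟩
  · exact ⟨KernelMMD.tendsto_mmd_of_forall_growthSpace hk hk_cont hQ hP
        (KernelMMD.isTight_singleton hX P) h,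
      KernelMMD.isTight_range_of_tendsto hX (KernelMMD.tendsto_of_forall_growthSpace hu0 h),
      KernelMMD.uniformlyIntegrates_of_forall_growthSpace hu0 huc hQ hP h⟩
  · refine KernelMMD.tendsto_integral_of_mem_growthSpace
      (KernelMMD.tendsto_of_separates hk hk_cont hsep hQ hmmd htight hui) hu0 huc hQ
      (fun ε hε => ?_) hf
    exact (KernelMMD.integral_max_sub_const_lt_of_uniformlyIntegrates hu0 huc.measurable
      (by rintro _ ⟨n, rfl⟩; exact hQ n) hui hε).mono fun r hr n => hr _ (mem_range_self n)
  · refine tendsto_nhds_unique tendsto_const_nhds (KernelMMD.tendsto_of_forall_growthSpace hu0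
      ((H (fun _ => Q) fun _ => hQ).2 ⟨by simp [hQP], ?_, ?_⟩))
    · simpa using KernelMMD.isTight_singleton hX Q
    · simpa using KernelMMD.uniformlyIntegrates_singleton hu0 huc.measurable hQ
  · have hbdd (x : X) : |KernelMMD.sqrtDiag k x| ≤ √C := by
      rw [abs_of_nonneg (hu0 x)]
      exact Real.sqrt_le_sqrt ((le_abs_self _).trans (hC x x))
    have huniv : KernelMMD.bochnerEmbeddable k = univ := eq_univ_of_forall fun Q =>
      (integrable_const (√C)).mono' huc.aestronglyMeasurable (ae_of_all _ hbdd)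
    refine ⟨fun hsep Q hmmd htight => ?_, fun H Q _ hQP => ?_⟩
    · exact KernelMMD.tendsto_of_separates hk hk_cont (huniv ▸ hsep) (fun n => huniv ▸ mem_univ _)
        hmmd htight (KernelMMD.uniformlyIntegrates_of_le hbdd _)
    · exact tendsto_nhds_unique tendsto_const_nhds (H (fun _ => Q) (by simp [hQP])
        (by simpa using KernelMMD.isTight_singleton hX Q))
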